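/- **Setting.** Let $C=\{1,\dots,m\}$ be a set of candidates, $V=\{1,\dots,n\}$ a set of voters and $k$ an integer with $2\le k<m$. Each voter $i$ has a utility function $u_i:C\to\mathbb{R}_{\ge 0}$, extended additively by $u_i(W)=\sum_{c\in W}u_i(c)$ for $W\subseteq C$. The Nash Welfare of $W$ is $\Pi(W)=\sum_{i\in V}\log(1+u_i(W))$. A committee $W\subseteq C$ is feasible if $|W|\le k$. **Online Nash Rule.** Let $s=\lceil m/k\rceil$. If $k\nmid m$, add $ks-m$ dummy candidates that have utility $0$ for all voters. The $ks$ candidates arrive one by one, and the stream is split into $k$ consecutive segments of $s$ candidates each. Every candidate $c$ has a fixed priority $\tau(c)\in\mathbb{N}$, independent of the arrival order. Start with $T_0=\emptyset$. In segment $i=1,\dots,k$ put $g_i(c)=\Pi(T_{i-1}\cup\{c\})$. Candidates of the segment are compared by $g_i$, and those with equal $g_i$ by $\tau$. The first $\lfloor s/e\rfloor$ candidates of the segment are observed without being hired. Then the first later candidate that is at least as good as every observed one is hired, or the last candidate of the segment if there is no such candidate. $T_i$ is $T_{i-1}$ together with the hired candidate. The rule returns the set $T_k\cap C$ of hired candidates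 that are not dummies. **Theorem.** For every arrival order the Online Nash Rule returns a feasible committee. Suppose moreover that the priorities resolve all ties: whenever $|T|<k$ and $c\ne c'$ are candidates (dummies included) outside $T$ with $\Pi(T\cup\{c\})=\Pi(T\cup\{c'\})$, then $\tau(c)\ne\tau(c')$. (This holds if all priorities are distinct. It also holds with constant priorities, i.e. when candidates are compared by $g_i$ alone, provided that no such equality occurs.) If the arrival order (of all $ks$ candidates, dummies included) is uniformly random, then the committee $W$ that the rule returns satisfies $$\mathbb{E}[\Pi(W)]\ \ge\ \frac{1-1/e}{7}\ \max_{W^*\subseteq C,\ |W^*|\le k}\Pi(W^*).$$ -/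

import Mathlib

open scoped BigOperators

namespace OnlineNash

/-- Nash Welfare `∑ i, log (1 + u_i(W))` of the set `W` under the additive utilities `u`. -/
noncomputable def nash {n : ℕ} {α : Type*} (u : Fin n → α → ℝ) (W : Finset α) : ℝ :=
  ∑ i, Real.log (1 + ∑ c ∈ W, u i c)

/-- The offline maximum of the Nash Welfare over all committees of at most `k` candidates. -/
noncomputable def maxNash {n m : ℕ} (k : ℕ) (u : Fin n → Fin m → ℝ) : ℝ :=
  (Finset.univ.filter fun W : Finset (Fin m) => W.card ≤ k).sup' ⟨∅, by simp⟩ (nash u)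

/-- `g(c) = nash (T ∪ {c})`: the value of hiring `c` on top of the already hired set `T`. -/
noncomputable def gain {n : ℕ} {α : Type*} [DecidableEq α] (u : Fin n → α → ℝ)
    (T : Finset α) (c : α) : ℝ :=
  nash u (T ∪ {c})

/-- `c` is at least as good as `c'` given `T`: the gain decides, and equal gains are compared by
the priorities `tie`. For constant `tie` this is just `gain u T c' ≤ gain u T c`. -/
def AtLeast {n : ℕ} {α : Type*} [DecidableEq α] (u : Fin n → α → ℝ) (tie : α → ℕ)
    (T : Finset α) (c' c : α) : Prop :=
  gain u T c' < gain u T c ∨ (gain u T c' = gain u T c ∧ tie c' ≤ tie c)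

/-- The priorities `tie` separate any two distinct candidates whose gains coincide on top of a
set of fewer than `k` other candidates. Every injective `tie` does so; a constant `tie` does so
exactly when no such coincidence occurs. -/
def ResolvesTies {n : ℕ} {α : Type*} [DecidableEq α] (k : ℕ) (u : Fin n → α → ℝ)
    (tie : α → ℕ) : Prop :=
  ∀ (T : Finset α) (c c' : α), T.card < k → c ∉ T → c' ∉ T → c ≠ c' →
    gain u T c = gain u T c' → tie c ≠ tie c'

open Classical in
/-- The secretary procedure on one segment `S`, listed in arrival order, when `T` has been hired
before. The first `⌊|S| / e⌋` candidates are only observed. The first later candidate that is at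
least as good as all the observed ones (equivalently, as the best of them) is hired, and
the last candidate of the segment is hired if there is none. -/
noncomputable def hire {n : ℕ} {α : Type*} [DecidableEq α] (u : Fin n → α → ℝ) (tie : α → ℕ)
    (T : Finset α) (S : List α) : Option α :=
  let r := ⌊(S.length : ℝ) / Real.exp 1⌋₊
  ((S.drop r).find? fun c => decide (∀ c' ∈ S.take r, AtLeast u tie T c' c)).or
    (S.drop r).getLast?

/-- The set of candidates hired in the first `i` segments, all of length `s`, of the stream `L`. -/
noncomputable def hired {n : ℕ} {α : Type*} [DecidableEq α] (u : Fin n → α → ℝ) (tie : α → ℕ)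
    (s : ℕ) (L : List α) : ℕ → Finset α
  | 0 => ∅
  | i + 1 =>
    hired u tie s L i ∪ (hire u tie (hired u tie s L i) ((L.drop (i * s)).take s)).toFinset

/-- The length of the stream: the least multiple of `k` that is at least `m`. -/
def streamLength (m k : ℕ) : ℕ := k * (m ⌈/⌉ k)

/-- The utilities on the stream's candidates `0, …, N - 1`. Those below `m` are the candidates
of the election, the others are dummy candidates without support. -/
def padded {n m : ℕ} (N : ℕ) (u : Fin n → Fin m → ℝ) (i : Fin n) (x : Fin N) : ℝ :=
  if h : (x : ℕ) < m then u i ⟨x, h⟩ else 0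

/-- The committee returned by the Online Nash Rule for committee size `k` when the candidates
(with the dummies, if any) arrive in the order `σ 0, σ 1, …`. Dummies that were hired are dropped.
-/
noncomputable def rule {n m : ℕ} (k : ℕ) (u : Fin n → Fin m → ℝ)
    (tie : Fin (streamLength m k) → ℕ) (σ : Equiv.Perm (Fin (streamLength m k))) :
    Finset (Fin m) :=
  Finset.univ.filter fun c =>
    ∃ x ∈ hired (padded (streamLength m k) u) tie (m ⌈/⌉ k) (List.ofFn σ) k, (x : ℕ) = (c : ℕ)

end OnlineNash

open scoped BigOperators

namespace OnlineNash

/-! ### Nash Welfare: monotonicity, submodularity, additive minorants. -/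

section Nash

variable {n : ℕ} {α : Type*} {u : Fin n → α → ℝ}

/-! Compare with an optimal committee `O` filled up to exactly `k` members. Write `T` for the set
hired before segment `i`.

If members of `O` arrive in the segment, its best increase is at least the average of their marginal
gains on top of `T`. Exchanging two members of `O` that arrive after `T` is fixed does not affect
`T`, so on average this equals the mean gain over all members of `O` still to come. By submodularity
their gains total at least their own Nash Welfare minus that of `T`. The former is bounded below by
an additive minorant, exact at `O`, whose per-member average is that of `O`; the latter is charged
by exchanging positions, at a cost of at most `1 / (k - i)`. The segment meets `O` with probability
at least `1 - (1 - 1/k)^k ≥ 1 - 1/e`. This is `le_sum_bestIncrease`.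

The secretary procedure realises at least `3 / 10` of the best increase on average
(`sum_bestIncrease_le`), since the payoff is invariant under permuting the positions of a segment.
The resulting recursion for the expected welfare, `div_seven_le_of_increments`, yields the factor `1
/ 7`. -/

theorem nash_empty : nash u ∅ = 0 := by simp [nash]

theorem one_add_sum_pos (hu : ∀ i c, 0 ≤ u i c) (i : Fin n) (W : Finset α) :
    0 < 1 + ∑ c ∈ W, u i c := by
  have := Finset.sum_nonneg fun c (_ : c ∈ W) => hu i c
  linarith

theorem nash_mono (hu : ∀ i c, 0 ≤ u i c) {S T : Finset α} (h : S ⊆ T) :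
    nash u S ≤ nash u T := by
  refine Finset.sum_le_sum fun i _ => Real.log_le_log (one_add_sum_pos hu i S) ?_
  have := Finset.sum_le_sum_of_subset_of_nonneg h fun c _ _ => hu i c
  linarith

theorem nash_nonneg (hu : ∀ i c, 0 ≤ u i c) (S : Finset α) : 0 ≤ nash u S := by
  rw [← nash_empty (u := u)]
  exact nash_mono hu (Finset.empty_subset S)

/-- Submodularity of the logarithm: `a (a + x + y) ≤ (a + x) (a + y)` for `x, y ≥ 0`, applied to one
summand at a time. -/
theorem log_add_sum_le {ι : Type*} (J : Finset ι) (x : ι → ℝ) (hx : ∀ o ∈ J, 0 ≤ x o)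
    {a : ℝ} (ha : 0 < a) :
    Real.log (a + ∑ o ∈ J, x o) ≤ Real.log a + ∑ o ∈ J, (Real.log (a + x o) - Real.log a) := by
  classical
  induction J using Finset.induction_on with
  | empty => simp
  | insert o J ho ih =>
    have ih := ih fun p hp => hx p (Finset.mem_insert_of_mem hp)
    have hs : 0 ≤ ∑ p ∈ J, x p :=
      Finset.sum_nonneg fun p hp => hx p (Finset.mem_insert_of_mem hp)
    have ho' := hx o (Finset.mem_insert_self o J)
    rw [Finset.sum_insert ho, Finset.sum_insert ho]
    have key : Real.log a + Real.log (a + (x o + ∑ p ∈ J, x p)) ≤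
        Real.log (a + x o) + Real.log (a + ∑ p ∈ J, x p) := by
      rw [← Real.log_mul (by positivity) (by positivity),
        ← Real.log_mul (by positivity) (by positivity)]
      exact Real.log_le_log (by positivity) (by nlinarith [mul_nonneg ho' hs])
    linarith

/-- The marginal gains of the elements of `J` add up to at least `nash u J - nash u T`. -/
theorem nash_sub_le_sum_gain [DecidableEq α] (hu : ∀ i c, 0 ≤ u i c) {J T : Finset α}
    (h : ∀ o ∈ J, o ∉ T) :
    nash u J - nash u T ≤ ∑ o ∈ J, (gain u T o - nash u T) := by
  have : ∑ o ∈ J, (gain u T o - nash u T) = ∑ i, ∑ o ∈ J,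
      (Real.log ((1 + ∑ c ∈ T, u i c) + u i o) - Real.log (1 + ∑ c ∈ T, u i c)) := by
    rw [Finset.sum_comm]
    refine Finset.sum_congr rfl fun o ho => ?_
    rw [gain, nash, nash, ← Finset.sum_sub_distrib]
    refine Finset.sum_congr rfl fun i _ => ?_
    rw [Finset.sum_union (by simpa using h o ho), Finset.sum_singleton, add_assoc]
  rw [this, nash, nash, ← Finset.sum_sub_distrib]
  refine Finset.sum_le_sum fun i _ => ?_
  have h1 := log_add_sum_le J (u i) (fun o _ => hu i o) (one_add_sum_pos hu i T)
  have h2 : Real.log (1 + ∑ c ∈ J, u i c) ≤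
      Real.log ((1 + ∑ c ∈ T, u i c) + ∑ o ∈ J, u i o) := by
    refine Real.log_le_log (one_add_sum_pos hu i J) ?_
    have := Finset.sum_nonneg fun c (_ : c ∈ T) => hu i c
    linarith
  linarith

/-- Concavity of `log` between `1` and `1 + x`, using `log 1 = 0`. -/
theorem mul_log_le_log {t x : ℝ} (ht : 0 ≤ t) (ht1 : t ≤ 1) (hx : 0 ≤ x) :
    t * Real.log (1 + x) ≤ Real.log (1 + t * x) := by
  have := strictConcaveOn_log_Ioi.concaveOn.2 (x := 1 + x) (y := 1) (by simp; linarith) (by simp)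
    ht (sub_nonneg.2 ht1) (by ring)
  simp only [smul_eq_mul, Real.log_one, mul_zero, add_zero] at this
  rwa [show t * (1 + x) + (1 - t) * 1 = 1 + t * x by ring] at this

/-- The Nash Welfare has an additive minorant on the subsets of `O` that is exact at `O`. -/
theorem exists_additive_minorant (hu : ∀ i c, 0 ≤ u i c) (O : Finset α) :
    ∃ w : α → ℝ, (∀ J ⊆ O, ∑ o ∈ J, w o ≤ nash u J) ∧ ∑ o ∈ O, w o = nash u O := by
  -- Each voter's logarithm at `O` is shared out in proportion to the utilities. A voter with
  -- utility zero for `O` contributes `0 / 0 = 0`, which agrees with `log 1`.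
  refine ⟨fun o => ∑ i, u i o / (∑ c ∈ O, u i c) * Real.log (1 + ∑ c ∈ O, u i c), ?_, ?_⟩
  · intro J hJ
    rw [Finset.sum_comm, nash]
    refine Finset.sum_le_sum fun i _ => ?_
    rw [← Finset.sum_mul, ← Finset.sum_div]
    have hO := Finset.sum_nonneg fun c (_ : c ∈ O) => hu i c
    have hJ0 := Finset.sum_nonneg fun c (_ : c ∈ J) => hu i c
    have hJO := Finset.sum_le_sum_of_subset_of_nonneg hJ fun c _ _ => hu i c
    rcases hO.eq_or_lt with h | h
    · rw [← h]; simp [Real.log_nonneg (le_add_of_nonneg_right hJ0)]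
    · refine (mul_log_le_log (by positivity) (by rwa [div_le_one h]) hO).trans_eq ?_
      rw [div_mul_cancel₀ _ h.ne']
  · rw [Finset.sum_comm, nash]
    refine Finset.sum_congr rfl fun i _ => ?_
    rw [← Finset.sum_mul, ← Finset.sum_div]
    rcases eq_or_ne (∑ c ∈ O, u i c) 0 with h | h
    · simp [h]
    · rw [div_self h, one_mul]

end Nash

/-! ### Exchange arguments for uniformly random arrangements. -/

section Symmetry

open Equiv Finset

variable {α : Type*} [DecidableEq α]

/-- Exchangeability: reindexing by `e` shows that every `F b` has the same total as `F a`. -/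
theorem card_mul_sum_eq {ι Ω : Type*} [Fintype Ω] {Q : Finset ι} {F : ι → Ω → ℝ} {a : ι}
    (h : ∀ b ∈ Q, ∃ e : Ω ≃ Ω, ∀ σ, F b (e σ) = F a σ) :
    (#Q : ℝ) * ∑ σ, F a σ = ∑ σ, ∑ b ∈ Q, F b σ := by
  rw [sum_comm, ← nsmul_eq_mul, ← sum_const]
  refine sum_congr rfl fun b hb => ?_
  obtain ⟨e, he⟩ := h b hb
  rw [← Equiv.sum_comp e (F b)]
  exact sum_congr rfl fun σ _ => (he σ).symm

/-- The elements of `O` that the arrangement `σ` puts on a position in `Q`. -/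
def within (O Q : Finset α) (σ : Perm α) : Finset α := {o ∈ O | σ.symm o ∈ Q}

theorem mem_within {O Q : Finset α} {σ : Perm α} {o : α} :
    o ∈ within O Q σ ↔ o ∈ O ∧ σ.symm o ∈ Q := mem_filter

/-- Arrangements send positions to candidates, so a swap on the left exchanges two candidates and a
swap on the right exchanges two positions. -/
theorem symm_swap_mul (a b o : α) (σ : Perm α) :
    (swap a b * σ).symm o = σ.symm (swap a b o) := rfl

theorem symm_mul_swap (a b o : α) (σ : Perm α) :
    (σ * swap a b).symm o = swap a b (σ.symm o) := rfl

theorem swap_mem_iff {Q : Finset α} {a b : α} (ha : a ∈ Q) (hb : b ∈ Q) (c : α) :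
    swap a b c ∈ Q ↔ c ∈ Q := by
  rw [swap_apply_def]
  split_ifs with h1 h2 <;> simp_all

theorem card_within_swap_mul {O Q : Finset α} {a b : α} (ha : a ∈ O) (hb : b ∈ O)
    (σ : Perm α) : #(within O Q (swap a b * σ)) = #(within O Q σ) := by
  refine card_equiv (swap a b) fun o => ?_
  rw [mem_within, mem_within, symm_swap_mul, swap_mem_iff ha hb]

theorem within_mul_swap {O Q : Finset α} {a b : α} (ha : a ∈ Q) (hb : b ∈ Q)
    (σ : Perm α) : within O Q (σ * swap a b) = within O Q σ := by
  ext o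
  rw [mem_within, mem_within, symm_mul_swap, swap_mem_iff ha hb]

theorem card_filter_apply_mem {O Q : Finset α} (σ : Perm α) :
    #{q ∈ Q | σ q ∈ O} = #(within O Q σ) := by
  refine card_equiv σ fun q => ?_
  rw [mem_within, mem_filter, symm_apply_apply, and_comm]

theorem within_mono {O Q R : Finset α} (h : Q ⊆ R) (σ : Perm α) : within O Q σ ⊆ within O R σ :=
  fun _ ho => mem_within.2 ⟨(mem_within.1 ho).1, h (mem_within.1 ho).2⟩

/-- One if `σ` puts an element of `O` into `Q`, and zero otherwise. -/
def hit (O Q : Finset α) (σ : Perm α) : ℝ := if #(within O Q σ) = 0 then 0 else 1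

theorem hit_nonneg (O Q : Finset α) (σ : Perm α) : 0 ≤ hit O Q σ := by
  rw [hit]; split_ifs <;> norm_num

theorem hit_swap_mul {O Q : Finset α} {a b : α} (ha : a ∈ O) (hb : b ∈ O)
    (σ : Perm α) : hit O Q (swap a b * σ) = hit O Q σ := by
  rw [hit, hit, card_within_swap_mul ha hb]

theorem hit_le (O Q : Finset α) (σ : Perm α) : hit O Q σ ≤ #(within O Q σ) := by
  rw [hit]
  split_ifs with h
  · positivity
  · exact_mod_cast Nat.one_le_iff_ne_zero.2 h

theorem hit_ne_zero {O Q R : Finset α} (h : Q ⊆ R) {σ : Perm α} (h0 : #(within O Q σ) ≠ 0) :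
    (#(within O R σ) : ℝ) ≠ 0 := by
  have := card_le_card (within_mono (O := O) h σ)
  exact_mod_cast (by omega : #(within O R σ) ≠ 0)

variable [Fintype α]

/-- The average of `D` over the elements of `O` in `Q` may be replaced, on average over all
arrangements, by the average over the elements of `O` in a larger set `R`. -/
theorem sum_average_within (O : Finset α) {Q R : Finset α} (hQR : Q ⊆ R) (D : α → Perm α → ℝ)
    (hD : ∀ σ, ∀ a ∈ within O R σ, ∀ b ∈ within O R σ, ∀ c, D c (swap a b * σ) = D c σ) :
    ∑ σ, (∑ o ∈ within O Q σ, D o σ) / #(within O Q σ) =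
      ∑ σ, hit O Q σ / #(within O R σ) * ∑ o ∈ within O R σ, D o σ := by
  -- `X` picks a uniform member of `O` in `Q`, and `Y` marks the members in `R`. Both sides become
  -- sums over pairs `(o, p)` that differ only by exchanging the arguments of `X` and `Y`.
  set X : α → Perm α → ℝ := fun o σ => if σ.symm o ∈ Q then 1 / (#(within O Q σ) : ℝ) else 0
    with hX
  set Y : α → Perm α → ℝ := fun o σ => if σ.symm o ∈ R then 1 else 0 with hY
  have sumY : ∀ σ, ∑ o ∈ O, Y o σ = #(within O R σ) := fun σ => by
    simp [hY, within]
  have sumX : ∀ σ, ∑ o ∈ O, X o σ = hit O Q σ := fun σ => by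
    simp only [hX]
    rw [← sum_filter, sum_const, nsmul_eq_mul]
    change (#(within O Q σ) : ℝ) * _ = _
    rw [hit]
    split_ifs with h
    · simp [h]
    · field_simp
  have lhs : ∀ σ, (∑ o ∈ within O Q σ, D o σ) / #(within O Q σ) =
      ∑ o ∈ O, ∑ p ∈ O, X o σ * Y p σ * D o σ / #(within O R σ) := fun σ => by
    have : ∀ o ∈ O, ∑ p ∈ O, X o σ * Y p σ * D o σ / #(within O R σ) = X o σ * D o σ := by
      intro o ho
      rw [← sum_div, ← sum_mul, ← mul_sum, sumY]
      by_cases h : σ.symm o ∈ Q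
      · have : (#(within O R σ) : ℝ) ≠ 0 :=
          hit_ne_zero hQR (card_ne_zero_of_mem (mem_within.2 ⟨ho, h⟩))
        field_simp
      · simp [hX, h]
    rw [sum_congr rfl this]
    simp only [hX, ite_mul, zero_mul]
    rw [← sum_filter, sum_div]
    exact sum_congr rfl fun o _ => by ring
  have rhs : ∀ σ, hit O Q σ / #(within O R σ) * ∑ o ∈ within O R σ, D o σ =
      ∑ o ∈ O, ∑ p ∈ O, X p σ * Y o σ * D o σ / #(within O R σ) := fun σ => by
    have : ∀ o ∈ O, ∑ p ∈ O, X p σ * Y o σ * D o σ / #(within O R σ) =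
        if σ.symm o ∈ R then hit O Q σ / #(within O R σ) * D o σ else 0 := by
      intro o ho
      rw [← sum_div, ← sum_mul, ← sum_mul, sumX]
      simp only [hY]
      split_ifs <;> ring
    rw [sum_congr rfl this, ← sum_filter, mul_sum]
    rfl
  rw [sum_congr rfl fun σ _ => lhs σ, sum_congr rfl fun σ _ => rhs σ, sum_comm,
    sum_comm (s := univ)]
  refine sum_congr rfl fun o ho => ?_
  rw [sum_comm, sum_comm (s := univ)]
  refine sum_congr rfl fun p hp => ?_
  -- Exchanging the candidates `o` and `p` turns one pair sum into the other. Where the weights are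
  -- nonzero both lie in `R`, so `D` does not change.
  rw [← Equiv.sum_comp (Equiv.mulLeft (swap o p))]
  refine sum_congr rfl fun σ _ => ?_
  simp only [coe_mulLeft, hX, hY, symm_swap_mul, swap_apply_left, swap_apply_right,
    card_within_swap_mul ho hp]
  split_ifs with h1 h2
  · rw [hD σ o (mem_within.2 ⟨ho, h2⟩) p (mem_within.2 ⟨hp, hQR h1⟩)]
  all_goals simp

/-- On average over all arrangements, an additive function of the elements of `O` in `R` takes its
share of the value at `O`. -/
theorem sum_hit_mul_additive {O : Finset α} {Q R : Finset α} (hQR : Q ⊆ R) (w : α → ℝ) :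
    #O * ∑ σ, hit O Q σ / #(within O R σ) * ∑ o ∈ within O R σ, w o =
      (∑ o ∈ O, w o) * ∑ σ, hit O Q σ := by
  set F : α → Perm α → ℝ := fun o σ =>
    if σ.symm o ∈ R then hit O Q σ / #(within O R σ) else 0 with hF
  have key : ∀ o ∈ O, (#O : ℝ) * ∑ σ, F o σ = ∑ σ, hit O Q σ := by
    intro o ho
    rw [card_mul_sum_eq fun b hb => ⟨Equiv.mulLeft (swap o b), fun σ => ?_⟩]
    · refine sum_congr rfl fun σ _ => ?_
      simp only [hF]
      rw [← sum_filter, sum_const, nsmul_eq_mul]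
      change (#(within O R σ) : ℝ) * _ = _
      rw [hit]
      split_ifs with h
      · simp
      · field_simp [hit_ne_zero hQR h]
    · simp only [hF, coe_mulLeft, symm_swap_mul, swap_apply_right, hit_swap_mul ho hb,
        card_within_swap_mul ho hb]
  have : ∀ σ, hit O Q σ / #(within O R σ) * ∑ o ∈ within O R σ, w o =
      ∑ o ∈ O, w o * F o σ := fun σ => by
    simp only [hF, mul_ite, mul_zero]
    rw [← sum_filter, mul_sum]
    exact sum_congr rfl fun o _ => mul_comm _ _
  rw [sum_congr rfl fun σ _ => this σ, sum_comm, mul_sum, sum_mul]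
  refine sum_congr rfl fun o ho => ?_
  rw [← key o ho, ← mul_sum]
  ring

/-- A hit is at most the number of positions in `Q` occupied by `O`. All positions in `R` are
exchangeable for `h`, and over `R` the weights `1 / #(within O R σ)` of the occupied positions add
up to at most one. Hence `Q` receives at most the share `#Q / #R`. -/
theorem sum_hit_mul_le {O Q R : Finset α} (hQR : Q ⊆ R) (h : Perm α → ℝ) (h0 : ∀ σ, 0 ≤ h σ)
    (hswap : ∀ σ, ∀ a ∈ R, ∀ b ∈ R, h (σ * swap a b) = h σ) :
    #R * ∑ σ, hit O Q σ / #(within O R σ) * h σ ≤ #Q * ∑ σ, h σ := by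
  set G : α → Perm α → ℝ := fun q σ => if σ q ∈ O then h σ / #(within O R σ) else 0 with hG
  have key : ∀ a ∈ Q, (#R : ℝ) * ∑ σ, G a σ ≤ ∑ σ, h σ := by
    intro a ha
    rw [card_mul_sum_eq fun b hb => ⟨Equiv.mulRight (swap a b), fun σ => ?_⟩]
    · refine sum_le_sum fun σ _ => ?_
      simp only [hG]
      rw [← sum_filter, sum_const, nsmul_eq_mul, card_filter_apply_mem]
      rcases eq_or_ne (#(within O R σ) : ℝ) 0 with h' | h'
      · simp [h', h0 σ]
      · rw [mul_div_cancel₀ _ h']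
    · simp only [hG, coe_mulRight, Perm.mul_apply, swap_apply_right,
        hswap σ a (hQR ha) b hb, within_mul_swap (hQR ha) hb]
  calc (#R : ℝ) * ∑ σ, hit O Q σ / #(within O R σ) * h σ
      ≤ #R * ∑ σ, ∑ a ∈ Q, G a σ := by
        refine mul_le_mul_of_nonneg_left (sum_le_sum fun σ _ => ?_) (by positivity)
        simp only [hG]
        rw [← sum_filter, sum_const, nsmul_eq_mul, card_filter_apply_mem, div_mul_eq_mul_div,
          mul_div_assoc]
        exact mul_le_mul_of_nonneg_right (hit_le O Q σ) (div_nonneg (h0 σ) (by positivity))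
    _ = ∑ a ∈ Q, #R * ∑ σ, G a σ := by rw [sum_comm, mul_sum]
    _ ≤ ∑ a ∈ Q, ∑ σ, h σ := sum_le_sum key
    _ = #Q * ∑ σ, h σ := by rw [sum_const, nsmul_eq_mul]

/-- A set `O` is missed by `Q` with probability at most `(1 - |Q| / |α|) ^ |O|`. -/
theorem sum_one_sub_hit_le [Nonempty α] (O Q : Finset α) :
    ∑ σ, (1 - hit O Q σ) ≤
      (1 - #Q / Fintype.card α : ℝ) ^ #O * Fintype.card (Perm α) := by
  have hα : (0 : ℝ) < Fintype.card α := by exact_mod_cast Fintype.card_pos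
  have hQα : (#Q : ℝ) ≤ Fintype.card α := by exact_mod_cast card_le_univ Q
  have h1 : (0 : ℝ) ≤ 1 - #Q / Fintype.card α := by
    rw [sub_nonneg, div_le_one hα]; exact hQα
  have hmiss : ∀ (O : Finset α) (σ : Perm α),
      1 - hit O Q σ = if ∀ o ∈ O, σ.symm o ∉ Q then 1 else 0 := by
    intro O σ
    have : #(within O Q σ) = 0 ↔ ∀ o ∈ O, σ.symm o ∉ Q := by
      rw [card_eq_zero, within, filter_eq_empty_iff]
    rw [hit, ← if_congr this rfl rfl]
    split_ifs <;> norm_num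
  simp only [hmiss]
  induction O using Finset.induction_on with
  | empty => simp
  | insert o O ho ih =>
    set A : Perm α → ℝ := fun σ => if ∀ o ∈ O, σ.symm o ∉ Q then 1 else 0 with hA
    -- `N q` counts the arrangements with `o` at position `q` in which the other members of `O`
    -- avoid `Q`.
    set N : α → ℝ := fun q => ∑ σ, if σ q = o then A σ else 0 with hN
    have total : ∑ q, N q = ∑ σ, A σ := by
      simp only [hN]
      rw [sum_comm]
      refine sum_congr rfl fun σ _ => ?_
      simp only [← Equiv.eq_symm_apply]
      simp
    have outside : ∑ q ∈ Qᶜ, N q =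
        ∑ σ : Perm α, if ∀ p ∈ insert o O, σ.symm p ∉ Q then (1 : ℝ) else 0 := by
      simp only [hN]
      rw [sum_comm]
      refine sum_congr rfl fun σ _ => ?_
      simp only [← Equiv.eq_symm_apply, sum_ite_eq', mem_compl, forall_mem_insert, hA]
      split_ifs <;> simp_all
    -- Negative dependence: moving `o` from outside `Q` to a position of `Q` pushes another
    -- candidate out, so the remaining members of `O` still avoid `Q`.
    have le : ∀ q ∈ Q, ∀ q' ∈ Qᶜ, N q' ≤ N q := by
      intro q hq q' hq'
      rw [mem_compl] at hq'
      simp only [hN]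
      rw [← Equiv.sum_comp (Equiv.mulRight (swap q q')) fun σ : Perm α =>
        if σ q = o then A σ else 0]
      refine sum_le_sum fun σ _ => ?_
      simp only [coe_mulRight, Perm.mul_apply, swap_apply_left]
      split_ifs with h
      · by_cases h2 : ∀ p ∈ O, σ.symm p ∉ Q
        · refine le_of_eq ?_
          simp only [hA]
          rw [if_pos h2, if_pos]
          intro p hp
          rw [symm_mul_swap, swap_apply_of_ne_of_ne]
          · exact h2 p hp
          · rintro rfl; exact h2 p hp hq
          · rintro rfl
            rw [apply_symm_apply] at h
            exact ho (h ▸ hp)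
        · simp only [hA]
          rw [if_neg h2]
          split_ifs <;> norm_num
      · rfl
    have cross : (#Q : ℝ) * ∑ q ∈ Qᶜ, N q ≤ #Qᶜ * ∑ q ∈ Q, N q := by
      calc (#Q : ℝ) * ∑ q ∈ Qᶜ, N q = ∑ q ∈ Q, ∑ q' ∈ Qᶜ, N q' := by
            rw [sum_const, nsmul_eq_mul]
        _ ≤ ∑ q ∈ Q, ∑ _q' ∈ Qᶜ, N q :=
            sum_le_sum fun q hq => sum_le_sum fun q' hq' => le q hq q' hq'
        _ = #Qᶜ * ∑ q ∈ Q, N q := by simp only [sum_const, nsmul_eq_mul, mul_sum]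
    have split := sum_compl_add_sum Q N
    have hc : (#Qᶜ : ℝ) = Fintype.card α - #Q := by
      rw [card_compl, Nat.cast_sub (card_le_univ Q)]
    rw [← outside, card_insert_of_notMem ho, pow_succ']
    have : ∑ q ∈ Qᶜ, N q ≤ (1 - #Q / Fintype.card α) * ∑ σ, A σ := by
      rw [one_sub_div hα.ne', div_mul_eq_mul_div, le_div_iff₀ hα, ← total, ← split]
      rw [hc] at cross
      linarith
    refine this.trans ?_
    rw [mul_assoc]
    exact mul_le_mul_of_nonneg_left ih h1

end Symmetry

/-! ### The secretary problem with an invariant payoff. -/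

section Secretary

open Equiv Finset

variable {α κ : Type*} [Fintype α] [DecidableEq α] [LinearOrder κ] {s : ℕ}

/-- The candidate at the position `e j` is the best one at the positions `e 0, …, e (s - 1)`. -/
def IsBest (e : Fin s → α) (key : Perm α → α → κ) (σ : Perm α) (j : Fin s) : Prop :=
  ∀ l, key σ (σ (e l)) ≤ key σ (σ (e j))

/-- The candidate at the position `e a` is the best one that arrives before the position `e j`. -/
def IsLeader (e : Fin s → α) (key : Perm α → α → κ) (σ : Perm α) (j a : Fin s) : Prop :=
  a < j ∧ ∀ b < j, key σ (σ (e b)) ≤ key σ (σ (e a))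

-- By injectivity of the key exactly one of the `s` exchangeable positions holds the best candidate,
-- so each carries the share `1 / s` of `M`.
open Classical in
theorem secretary_isBest {e : Fin s → α} (he : e.Injective) {key : Perm α → α → κ}
    (hkey : ∀ σ a b, key (σ * swap (e a) (e b)) = key σ)
    (hinj : ∀ σ, Function.Injective fun l => key σ (σ (e l)))
    {M : Perm α → ℝ} (hM : ∀ σ a b, M (σ * swap (e a) (e b)) = M σ) (j : Fin s) :
    s * ∑ σ, (if IsBest e key σ j then M σ else 0) = ∑ σ, M σ := by
  have := card_mul_sum_eq (Q := univ) (F := fun j σ => if IsBest e key σ j then M σ else 0)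
    (a := j) fun b _ => ⟨Equiv.mulRight (swap (e j) (e b)), fun σ => ?_⟩
  · rw [card_univ, Fintype.card_fin] at this
    rw [this]
    refine sum_congr rfl fun σ _ => ?_
    obtain ⟨q, -, hq⟩ := exists_max_image univ (fun l => key σ (σ (e l))) ⟨j, mem_univ j⟩
    rw [sum_eq_single q]
    · exact if_pos fun l => hq l (mem_univ l)
    · intro b _ hb
      exact if_neg fun h => hb (hinj σ (le_antisymm (hq b (mem_univ b)) (h q)))
    · simp
  · refine if_congr ?_ (hM _ _ _) rfl
    simp only [IsBest, coe_mulRight, hkey, Perm.mul_apply, he.swap_apply, swap_apply_right]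
    exact (swap j b).forall_congr_left.trans (by simp)

-- Exchanging two positions before `j` keeps the best candidate at `j`, and exactly one of these `j`
-- positions holds the leader.
open Classical in
theorem secretary_isLeader {e : Fin s → α} (he : e.Injective) {key : Perm α → α → κ}
    (hkey : ∀ σ a b, key (σ * swap (e a) (e b)) = key σ)
    (hinj : ∀ σ, Function.Injective fun l => key σ (σ (e l)))
    {M : Perm α → ℝ} (hM : ∀ σ a b, M (σ * swap (e a) (e b)) = M σ) {j a : Fin s} (ha : a < j) :
    (j : ℕ) * ∑ σ, (if IsBest e key σ j ∧ IsLeader e key σ j a then M σ else 0) =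
      ∑ σ, if IsBest e key σ j then M σ else 0 := by
  have := card_mul_sum_eq (Q := Iio j)
    (F := fun a σ => if IsBest e key σ j ∧ IsLeader e key σ j a then M σ else 0)
    (a := a) fun b hb => ⟨Equiv.mulRight (swap (e a) (e b)), fun σ => ?_⟩
  · rw [Fin.card_Iio] at this
    rw [this]
    refine sum_congr rfl fun σ _ => ?_
    by_cases hb : IsBest e key σ j
    · obtain ⟨q, hqj, hq⟩ :=
        exists_max_image (Iio j) (fun l => key σ (σ (e l))) ⟨a, mem_Iio.2 ha⟩
      simp only [hb, true_and, if_true]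
      rw [sum_eq_single q]
      · exact if_pos ⟨mem_Iio.1 hqj, fun l hl => hq l (mem_Iio.2 hl)⟩
      · intro b hb hbq
        exact if_neg fun h => hbq (hinj σ (le_antisymm (hq b hb) (h.2 q (mem_Iio.1 hqj))))
      · exact fun h => absurd hqj h
    · simp [hb]
  · have hb := mem_Iio.1 hb
    have hj : swap a b j = j := swap_apply_of_ne_of_ne ha.ne' hb.ne'
    have hlt : ∀ l, swap a b l < j ↔ l < j := fun l => by
      simpa using swap_mem_iff (Q := Iio j) (mem_Iio.2 ha) (mem_Iio.2 hb) l
    refine if_congr (and_congr ?_ (and_congr (by simp [ha, hb]) ?_)) (hM _ _ _) rfl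
    · simp only [IsBest, coe_mulRight, hkey, Perm.mul_apply, he.swap_apply, hj]
      exact (swap a b).forall_congr_left.trans (by simp)
    · simp only [coe_mulRight, hkey, Perm.mul_apply, he.swap_apply, swap_apply_right]
      exact (swap a b).forall_congr_left.trans (by simp [hlt])

open Classical in
/-- The secretary bound: a payoff that is at least `M` whenever the best candidate comes after the
first `r` positions and the best of the candidates before it is among the first `r`. -/
theorem secretary_bound {e : Fin s → α} (he : e.Injective) {key : Perm α → α → κ}
    (hkey : ∀ σ a b, key (σ * swap (e a) (e b)) = key σ)
    (hinj : ∀ σ, Function.Injective fun l => key σ (σ (e l)))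
    {M G : Perm α → ℝ} (hM : ∀ σ a b, M (σ * swap (e a) (e b)) = M σ) (hG : ∀ σ, 0 ≤ G σ)
    (r : ℕ)
    (h : ∀ σ j a, IsBest e key σ j → IsLeader e key σ j a → (a : ℕ) < r → r ≤ (j : ℕ) →
      M σ ≤ G σ) :
    (∑ j ∈ Ico r s, (r / (j * s) : ℝ)) * ∑ σ, M σ ≤ ∑ σ, G σ := by
  -- The events for different pairs (best position, leader position) are disjoint, so at most one
  -- summand is present.
  have pt : ∀ σ, ∑ p ∈ {p : Fin s × Fin s | (p.2 : ℕ) < r ∧ r ≤ (p.1 : ℕ)},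
      (if IsBest e key σ p.1 ∧ IsLeader e key σ p.1 p.2 then M σ else 0) ≤ G σ := by
    intro σ
    rw [← sum_filter]
    set P := filter (fun p : Fin s × Fin s => IsBest e key σ p.1 ∧ IsLeader e key σ p.1 p.2)
      {p : Fin s × Fin s | (p.2 : ℕ) < r ∧ r ≤ (p.1 : ℕ)} with hP
    have card : #P ≤ 1 := by
      refine card_le_one.2 fun p hp q hq => ?_
      simp only [hP, mem_filter, mem_univ, true_and] at hp hq
      have h1 : p.1 = q.1 := hinj σ (le_antisymm (hq.2.1 _) (hp.2.1 _))
      exact Prod.ext h1 (hinj σ (le_antisymm (hq.2.2.2 _ (h1 ▸ hp.2.2.1))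
        (hp.2.2.2 _ (h1 ▸ hq.2.2.1))))
    rcases Nat.le_one_iff_eq_zero_or_eq_one.1 card with h0 | h1
    · rw [card_eq_zero.1 h0]; simpa using hG σ
    · obtain ⟨p, hp⟩ := card_eq_one.1 h1
      have hpP : p ∈ P := hp ▸ mem_singleton_self p
      simp only [hP, mem_filter, mem_univ, true_and] at hpP
      rw [hp, sum_singleton]
      exact h σ p.1 p.2 hpP.2.1 hpP.2.2 hpP.1.1 hpP.1.2
  refine le_trans (le_of_eq ?_) (sum_le_sum fun σ _ => pt σ)
  rw [sum_comm]
  have term : ∀ p ∈ ({p : Fin s × Fin s | (p.2 : ℕ) < r ∧ r ≤ (p.1 : ℕ)} : Finset _),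
      ∑ σ, (if IsBest e key σ p.1 ∧ IsLeader e key σ p.1 p.2 then M σ else 0) =
        (∑ σ, M σ) / (p.1 * s : ℝ) := by
    intro p hp
    simp only [mem_filter, mem_univ, true_and] at hp
    have hs : (s : ℝ) ≠ 0 := by have := p.1.2; exact_mod_cast (by omega : s ≠ 0)
    have hj : ((p.1 : ℕ) : ℝ) ≠ 0 := by exact_mod_cast (by omega : (p.1 : ℕ) ≠ 0)
    rw [← secretary_isBest he hkey hinj hM p.1,
      ← secretary_isLeader he hkey hinj hM (Fin.lt_def.2 (hp.1.trans_le hp.2))]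
    field_simp
  have Ico_eq : Ico r s = {j ∈ range s | r ≤ j} := by
    ext j; simp only [mem_Ico, mem_filter, mem_range, and_comm]
  rw [sum_congr rfl term, ← univ_product_univ, sum_filter, sum_product, sum_mul, Ico_eq,
    sum_filter, sum_range]
  refine sum_congr rfl fun j _ => ?_
  split_ifs with hj
  · have range_eq : range r = {a ∈ range s | a < r} := by
      ext a
      have := j.2
      simp only [mem_filter, mem_range]
      omega
    simp only [hj, and_true]
    rw [← sum_range fun a => if a < r then (∑ σ, M σ) / ((j : ℕ) * s : ℝ) else 0, ← sum_filter,
      ← range_eq, sum_const, card_range, nsmul_eq_mul]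
    ring
  · simp [hj]

end Secretary

/-! ### Numerical bound for the success probability. -/

section Constant

open Finset

/-- Rational bounds `2.718 < e < 2.7183` make the sample size accessible to integer arithmetic. -/
theorem floor_div_exp_bounds (s : ℕ) :
    2718 * ⌊(s : ℝ) / Real.exp 1⌋₊ ≤ 1000 * s ∧
      10000 * s < 27183 * (⌊(s : ℝ) / Real.exp 1⌋₊ + 1) := by
  have e0 := Real.exp_pos 1
  have e1 := Real.exp_one_gt_d9
  have e2 := Real.exp_one_lt_d9
  set r := ⌊(s : ℝ) / Real.exp 1⌋₊
  have h1 : (r : ℝ) ≤ s / Real.exp 1 := Nat.floor_le (by positivity)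
  have h2 : (s : ℝ) / Real.exp 1 < r + 1 := Nat.lt_floor_add_one _
  rw [le_div_iff₀ e0] at h1
  rw [div_lt_iff₀ e0] at h2
  have hr : (0 : ℝ) ≤ r := by positivity
  constructor
  · have : (2718 : ℝ) * r ≤ 1000 * s := by nlinarith
    exact_mod_cast this
  · have : (10000 : ℝ) * s < 27183 * (r + 1) := by nlinarith
    exact_mod_cast this

/-- Telescoping of `log (1 + 1 / s) ≤ 1 / s`. -/
theorem log_div_le_sum_inv {r s : ℕ} (hr : 0 < r) (hrs : r ≤ s) :
    Real.log (s / r) ≤ ∑ j ∈ Ico r s, (1 / j : ℝ) := by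
  induction s, hrs using Nat.le_induction with
  | base => simp [hr.ne']
  | succ s hs ih =>
    have hs0 : (0 : ℝ) < s := by exact_mod_cast hr.trans_le hs
    have hr0 : (0 : ℝ) < r := by exact_mod_cast hr
    rw [sum_Ico_succ_top hs]
    have : Real.log ((s + 1 : ℕ) / r) = Real.log (s / r) + Real.log (1 + 1 / s) := by
      rw [← Real.log_mul (by positivity) (by positivity)]
      congr 1
      push_cast
      field_simp
    rw [this]
    have := Real.log_le_sub_one_of_pos (x := 1 + 1 / (s : ℝ)) (by positivity)
    linarith

/-- The success probability of the secretary procedure on at least three candidates is at least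
`3 / 10`. -/
theorem secretary_const {s : ℕ} (hs : 3 ≤ s) :
    3 / 10 ≤ ∑ j ∈ Ico ⌊(s : ℝ) / Real.exp 1⌋₊ s,
      ((⌊(s : ℝ) / Real.exp 1⌋₊ : ℕ) / (j * s) : ℝ) := by
  obtain ⟨h1, h2⟩ := floor_div_exp_bounds s
  have hfl : ((⌊(s : ℝ) / Real.exp 1⌋₊ : ℕ) : ℝ) ≤ s / Real.exp 1 :=
    Nat.floor_le (by positivity)
  generalize ⌊(s : ℝ) / Real.exp 1⌋₊ = r at *
  have hs0 : (0 : ℝ) < s := by exact_mod_cast (by omega : 0 < s)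
  have hr0 : (0 : ℝ) < r := by exact_mod_cast (by omega : 0 < r)
  -- The harmonic sum is at least `log (s / r) ≥ 1` because `r ≤ s / e`, so the probability is at
  -- least `r / s`.
  have big : 3 * s ≤ 10 * r → 3 / 10 ≤ ∑ j ∈ Ico r s, (r / (j * s) : ℝ) := by
    intro h
    have : ∑ j ∈ Ico r s, (r / (j * s) : ℝ) = r / s * ∑ j ∈ Ico r s, (1 / j : ℝ) := by
      rw [mul_sum]
      exact sum_congr rfl fun j _ => by rw [div_mul_div_comm, mul_one, mul_comm (s : ℝ)]
    rw [this]
    have hlog : 1 ≤ ∑ j ∈ Ico r s, (1 / j : ℝ) := by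
      refine le_trans ?_ (log_div_le_sum_inv (by omega) (by omega))
      rw [Real.le_log_iff_exp_le (by positivity), le_div_iff₀ hr0]
      rwa [le_div_iff₀ (Real.exp_pos 1), mul_comm] at hfl
    have hrs : (3 / 10 : ℝ) ≤ r / s := by
      rw [le_div_iff₀ hs0]
      have : (3 * s : ℝ) ≤ 10 * r := by exact_mod_cast h
      linarith
    nlinarith
  by_cases h : 3 * s ≤ 10 * r
  · exact big h
  -- The rounding loss `s / e - r < 1` can push `r / s` below `3 / 10` only for small `s`; there the
  -- sum is evaluated exactly.
  · have hs' : s ≤ 14 := by omega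
    interval_cases s <;> first
      | omega
      | (have : r = 1 := by omega
         subst this
         norm_num [sum_Ico_succ_top])
      | (have : r = 2 := by omega
         subst this
         norm_num [sum_Ico_succ_top])

end Constant

/-! ### One segment of the rule. -/

section Hire

variable {n : ℕ} {α : Type*} [DecidableEq α] (u : Fin n → α → ℝ) (tie : α → ℕ)

/-- The quantity by which the candidates are compared: the gain and then the priority. -/
noncomputable def rank (T : Finset α) (c : α) : ℝ ×ₗ ℕ := toLex (gain u T c, tie c)

variable {u tie}

theorem atLeast_iff {T : Finset α} {c' c : α} :
    AtLeast u tie T c' c ↔ rank u tie T c' ≤ rank u tie T c := by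
  rw [rank, rank, Prod.Lex.toLex_le_toLex]
  rfl

theorem gain_le_of_rank_le {T : Finset α} {c' c : α} (h : rank u tie T c' ≤ rank u tie T c) :
    gain u T c' ≤ gain u T c := by
  rcases atLeast_iff.2 h with h | h
  · exact h.le
  · exact h.1.le

theorem ResolvesTies.eq_of_rank_eq {k : ℕ} (h : ResolvesTies k u tie) {T : Finset α}
    (hT : T.card < k) {c c' : α} (hc : c ∉ T) (hc' : c' ∉ T)
    (he : rank u tie T c = rank u tie T c') : c = c' := by
  by_contra hne
  have := Prod.ext_iff.1 (toLex.injective he)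
  exact h T c c' hT hc hc' hne this.1 this.2

theorem mem_of_hire {T : Finset α} {S : List α} {c : α} (h : hire u tie T S = some c) :
    c ∈ S := by
  rw [hire, Option.or_eq_some_iff] at h
  rcases h with h | ⟨-, h⟩
  · exact List.mem_of_mem_drop (List.mem_of_find?_eq_some h)
  · exact List.mem_of_mem_drop (List.mem_of_getLast? h)

/-- The best candidate always qualifies. An earlier unobserved one that qualifies would have the
same rank as the leader, hence be the leader, which was observed. -/
theorem hire_ofFn {s : ℕ} {w : Fin s → α} {T : Finset α}
    (hinj : Function.Injective fun l => rank u tie T (w l)) {j a : Fin s}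
    (hbest : ∀ l, rank u tie T (w l) ≤ rank u tie T (w j))
    (hlead : ∀ b < j, rank u tie T (w b) ≤ rank u tie T (w a))
    (ha : (a : ℕ) < ⌊(s : ℝ) / Real.exp 1⌋₊) (hj : ⌊(s : ℝ) / Real.exp 1⌋₊ ≤ (j : ℕ)) :
    hire u tie T (List.ofFn w) = some (w j) := by
  rw [hire, List.length_ofFn, Option.or_eq_some_iff]
  left
  generalize ⌊(s : ℝ) / Real.exp 1⌋₊ = r at *
  rw [List.find?_eq_some_iff_getElem]
  have hjs := j.2
  refine ⟨?_, (j : ℕ) - r, by simp; omega, by simp [Nat.add_sub_cancel' hj], ?_⟩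
  · simp only [decide_eq_true_eq]
    intro c hc
    obtain ⟨l, hl⟩ := (List.mem_ofFn' _ _).1 (List.mem_of_mem_take hc)
    exact atLeast_iff.2 (hl ▸ hbest l)
  · intro b hb
    have hmem : w a ∈ (List.ofFn w).take r := by
      rw [List.mem_take_iff_getElem]
      exact ⟨a, by simp [ha], by simp⟩
    simp only [List.getElem_drop, List.getElem_ofFn, Bool.not_eq_true', decide_eq_false_iff_not]
    intro h
    have hle := atLeast_iff.1 (h _ hmem)
    have := hinj (le_antisymm (hlead ⟨r + b, by omega⟩ (Fin.lt_def.2 (by simp; omega))) hle)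
    have := congrArg Fin.val this
    simp at this
    omega

/-- With nothing observed, the first candidate qualifies vacuously. -/
theorem hire_ofFn_zero {s : ℕ} (hs : 0 < s) {w : Fin s → α} {T : Finset α}
    (h0 : ⌊(s : ℝ) / Real.exp 1⌋₊ = 0) :
    hire u tie T (List.ofFn w) = some (w ⟨0, hs⟩) := by
  obtain ⟨s, rfl⟩ := Nat.exists_eq_succ_of_ne_zero hs.ne'
  rw [hire, List.length_ofFn, h0]
  simp

end Hire

/-! ### Dependence of the hired set on the arrivals so far. -/

section Hired

variable {n N s : ℕ} {u : Fin n → Fin N → ℝ} {tie : Fin N → ℕ}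

/-- The rule is online: later arrivals cannot affect earlier decisions. All invariance of the hired
set under swaps rests on this. -/
theorem hired_congr {α : Type*} [DecidableEq α] {u : Fin n → α → ℝ} {tie : α → ℕ} {L L' : List α}
    (i : ℕ) (h : L.take (i * s) = L'.take (i * s)) :
    hired u tie s L i = hired u tie s L' i := by
  induction i with
  | zero => rfl
  | succ i ih =>
    have hle : i * s ≤ (i + 1) * s := Nat.mul_le_mul_right s i.le_succ
    have h' := congrArg (List.take (i * s)) h
    rw [List.take_take, List.take_take, min_eq_left hle] at h'
    have hd : (L.drop (i * s)).take s = (L'.drop (i * s)).take s := by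
      have := congrArg (List.drop (i * s)) h
      rwa [List.drop_take, List.drop_take, Nat.succ_mul, Nat.add_sub_cancel_left] at this
    rw [hired, hired, ih h', hd]

theorem mem_take_of_mem_hired {α : Type*} [DecidableEq α] {u : Fin n → α → ℝ} {tie : α → ℕ}
    {L : List α} {i : ℕ} {c : α} (h : c ∈ hired u tie s L i) : c ∈ L.take (i * s) := by
  induction i with
  | zero => simp [hired] at h
  | succ i ih =>
    rw [hired, Finset.mem_union, Option.mem_toFinset, Option.mem_def] at h
    rw [Nat.succ_mul, List.take_add, List.mem_append]
    exact h.imp ih mem_of_hire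

theorem card_hired_le {α : Type*} [DecidableEq α] {u : Fin n → α → ℝ} {tie : α → ℕ}
    {L : List α} (i : ℕ) : (hired u tie s L i).card ≤ i := by
  induction i with
  | zero => simp [hired]
  | succ i ih =>
    rw [hired]
    refine (Finset.card_union_le _ _).trans (add_le_add ih ?_)
    rw [Option.card_toFinset]
    cases hire u tie (hired u tie s L i) ((L.drop (i * s)).take s) <;> simp

theorem hired_ofFn_congr (i : ℕ) {σ τ : Equiv.Perm (Fin N)}
    (h : ∀ q : Fin N, (q : ℕ) < i * s → σ q = τ q) :
    hired u tie s (List.ofFn σ) i = hired u tie s (List.ofFn τ) i := by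
  refine hired_congr i (List.ext_getElem (by simp) fun q h1 h2 => ?_)
  simp only [List.length_take, List.length_ofFn, lt_min_iff] at h1
  simpa using h ⟨q, h1.2⟩ h1.1

theorem symm_lt_of_mem_hired {i : ℕ} {σ : Equiv.Perm (Fin N)} {c : Fin N}
    (h : c ∈ hired u tie s (List.ofFn σ) i) : (σ.symm c : ℕ) < i * s := by
  obtain ⟨q, hq, rfl⟩ := List.mem_take_iff_getElem.1 (mem_take_of_mem_hired h)
  simp only [List.length_ofFn, lt_min_iff] at hq
  simpa using hq.1

theorem segment_lt {k i : ℕ} (hN : N = k * s) (hi : i < k) (l : Fin s) : i * s + l < N := by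
  have := Nat.mul_le_mul_right s hi
  rw [Nat.succ_mul] at this
  omega

/-- The positions of the segment with index `i`. -/
def segment {k i : ℕ} (hN : N = k * s) (hi : i < k) (l : Fin s) : Fin N :=
  ⟨i * s + l, segment_lt hN hi l⟩

theorem segment_injective {k i : ℕ} (hN : N = k * s) (hi : i < k) :
    Function.Injective (segment hN hi) := by
  intro a b h
  have := congrArg Fin.val h
  simp only [segment] at this
  exact Fin.ext (by omega)

theorem take_drop_ofFn {k i : ℕ} (hN : N = k * s) (hi : i < k) (σ : Equiv.Perm (Fin N)) :
    ((List.ofFn σ).drop (i * s)).take s = List.ofFn fun l => σ (segment hN hi l) := by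
  have := Nat.mul_le_mul_right s hi
  rw [Nat.succ_mul] at this
  refine List.ext_getElem (by simp; omega) fun q h1 h2 => ?_
  simp [segment]

end Hired

/-! ### Expected increase in one segment. -/

section Rule

open Equiv Finset

variable {n N k s : ℕ} {u : Fin n → Fin N → ℝ} {tie : Fin N → ℕ}

theorem hired_mul_swap {i : ℕ} (σ : Perm (Fin N))
    {a b : Fin N} (ha : i * s ≤ (a : ℕ)) (hb : i * s ≤ (b : ℕ)) :
    hired u tie s (List.ofFn (σ * swap a b : Perm (Fin N))) i =
      hired u tie s (List.ofFn σ) i := by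
  refine hired_ofFn_congr i fun q hq => ?_
  rw [Perm.mul_apply, swap_apply_of_ne_of_ne]
  · rintro rfl; omega
  · rintro rfl; omega

/-- The largest increase of the Nash Welfare by a candidate of the segment with index `i`. -/
noncomputable def bestIncrease (u : Fin n → Fin N → ℝ) (tie : Fin N → ℕ) (hN : N = k * s)
    (hs : 0 < s) {i : ℕ} (hi : i < k) (σ : Perm (Fin N)) : ℝ :=
  univ.sup' ⟨⟨0, hs⟩, mem_univ _⟩
      (fun l => gain u (hired u tie s (List.ofFn σ) i) (σ (segment hN hi l))) -
    nash u (hired u tie s (List.ofFn σ) i)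

theorem le_bestIncrease (hN : N = k * s) (hs : 0 < s) {i : ℕ} (hi : i < k) (σ : Perm (Fin N))
    (l : Fin s) :
    gain u (hired u tie s (List.ofFn σ) i) (σ (segment hN hi l)) -
        nash u (hired u tie s (List.ofFn σ) i) ≤ bestIncrease u tie hN hs hi σ :=
  sub_le_sub_right (le_sup' (fun l => gain u (hired u tie s (List.ofFn σ) i)
    (σ (segment hN hi l))) (mem_univ l)) _

theorem nash_le_gain (hu : ∀ i c, 0 ≤ u i c) (T : Finset (Fin N)) (c : Fin N) :
    nash u T ≤ gain u T c :=
  nash_mono hu subset_union_left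

theorem bestIncrease_nonneg (hu : ∀ i c, 0 ≤ u i c) (hN : N = k * s) (hs : 0 < s) {i : ℕ}
    (hi : i < k) (σ : Perm (Fin N)) : 0 ≤ bestIncrease u tie hN hs hi σ :=
  (sub_nonneg.2 (nash_le_gain hu _ _)).trans (le_bestIncrease hN hs hi σ ⟨0, hs⟩)

theorem bestIncrease_mul_swap (hN : N = k * s) (hs : 0 < s) {i : ℕ} (hi : i < k)
    (σ : Perm (Fin N)) (a b : Fin s) :
    bestIncrease u tie hN hs hi (σ * swap (segment hN hi a) (segment hN hi b)) =
      bestIncrease u tie hN hs hi σ := by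
  rw [bestIncrease, bestIncrease, hired_mul_swap σ (Nat.le_add_right _ _)
    (Nat.le_add_right _ _)]
  congr 1
  simp only [Perm.mul_apply, (segment_injective hN hi).swap_apply]
  refine le_antisymm (sup'_le _ _ fun l _ => ?_) (sup'_le _ _ fun l _ => ?_)
  · exact le_sup' (fun l => gain u _ (σ (segment hN hi l))) (mem_univ (swap a b l))
  · refine (le_of_eq ?_).trans (le_sup' (fun l => gain u _ (σ (segment hN hi (swap a b l))))
      (mem_univ (swap a b l)))
    simp only [swap_apply_self]

/-- Each segment secures at least `3 / 10` of the best possible increase on average. -/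
theorem sum_bestIncrease_le (hu : ∀ i c, 0 ≤ u i c) (hN : N = k * s) (hs : 2 ≤ s)
    (hres : ResolvesTies k u tie) {i : ℕ} (hi : i < k) :
    3 / 10 * ∑ σ : Perm (Fin N), bestIncrease u tie hN (by omega) hi σ ≤
      ∑ σ : Perm (Fin N), (nash u (hired u tie s (List.ofFn σ) (i + 1)) -
        nash u (hired u tie s (List.ofFn σ) i)) := by
  have hs0 : 0 < s := by omega
  set T : Perm (Fin N) → Finset (Fin N) := fun σ => hired u tie s (List.ofFn σ) i with hT
  set e := segment hN hi
  have he : Function.Injective e := segment_injective hN hi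
  set key : Perm (Fin N) → Fin N → ℝ ×ₗ ℕ := fun σ => rank u tie (T σ) with hkey
  have key_swap : ∀ σ a b, key (σ * swap (e a) (e b)) = key σ := fun σ a b => by
    simp only [hkey, hT]
    rw [hired_mul_swap σ (Nat.le_add_right _ _) (Nat.le_add_right _ _)]
  have notMem : ∀ σ l, σ (e l) ∉ T σ := fun σ l h => by
    have := symm_lt_of_mem_hired h
    rw [symm_apply_apply] at this
    exact absurd this (not_lt.2 (Nat.le_add_right _ _))
  -- Fewer than `k` candidates have been hired and the segment is disjoint from them, so the
  -- priorities resolve all ties within it.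
  have key_inj : ∀ σ, Function.Injective fun l => key σ (σ (e l)) := fun σ a b h =>
    he (σ.injective (hres.eq_of_rank_eq ((card_hired_le i).trans_lt hi) (notMem σ a)
      (notMem σ b) h))
  have M_swap := bestIncrease_mul_swap (u := u) (tie := tie) hN hs0 hi
  have next : ∀ σ : Perm (Fin N), hired u tie s (List.ofFn σ) (i + 1) =
      T σ ∪ (hire u tie (T σ) (List.ofFn fun l => σ (e l))).toFinset := fun σ => by
    rw [hired, take_drop_ofFn hN hi]
  have G_nonneg : ∀ σ : Perm (Fin N), 0 ≤ nash u (hired u tie s (List.ofFn σ) (i + 1)) -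
      nash u (T σ) := fun σ => by
    rw [sub_nonneg, next]
    exact nash_mono hu subset_union_left
  have G_eq : ∀ (σ : Perm (Fin N)) j, IsBest e key σ j →
      hire u tie (T σ) (List.ofFn fun l => σ (e l)) = some (σ (e j)) →
      bestIncrease u tie hN hs0 hi σ ≤
        nash u (hired u tie s (List.ofFn σ) (i + 1)) - nash u (T σ) := by
    intro σ j hj h
    rw [next, h, bestIncrease]
    refine sub_le_sub_right (sup'_le _ _ fun l _ => ?_) _
    have := gain_le_of_rank_le (hj l)
    simpa [gain] using this
  have M_nonneg := sum_nonneg fun σ (_ : σ ∈ univ) =>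
    bestIncrease_nonneg (tie := tie) hu hN hs0 hi σ
  by_cases h3 : 3 ≤ s
  · refine (mul_le_mul_of_nonneg_right (secretary_const h3) M_nonneg).trans
      (secretary_bound he key_swap key_inj M_swap G_nonneg _ fun σ j a hj ha har hrj => ?_)
    exact G_eq σ j hj (hire_ofFn (key_inj σ) hj ha.2 har hrj)
  -- For `s = 2` nothing is observed; the first candidate is hired and is the best with probability
  -- `1 / 2`.
  · classical
    have hs2 : s = 2 := by omega
    have h0 : ⌊(s : ℝ) / Real.exp 1⌋₊ = 0 := by
      have := (floor_div_exp_bounds s).1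
      omega
    have := secretary_isBest he key_swap key_inj M_swap ⟨0, hs0⟩
    have hle : ∑ σ, (if IsBest e key σ ⟨0, hs0⟩ then bestIncrease u tie hN hs0 hi σ else 0) ≤
        ∑ σ : Perm (Fin N), (nash u (hired u tie s (List.ofFn σ) (i + 1)) - nash u (T σ)) := by
      refine sum_le_sum fun σ _ => ?_
      split_ifs with hj
      · exact G_eq σ _ hj (hire_ofFn_zero hs0 h0)
      · exact G_nonneg σ
    have hs' : (s : ℝ) = 2 := by exact_mod_cast hs2
    rw [hs'] at this
    linarith

/-- On average, the best candidate of a segment increases the Nash Welfare considerably unless the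
candidates hired so far are already good. -/
theorem le_sum_bestIncrease (hu : ∀ i c, 0 ≤ u i c) (hN : N = k * s) (hs : 0 < s) {i : ℕ}
    (hi : i < k) {O : Finset (Fin N)} (hO : #O = k) :
    (1 - 1 / Real.exp 1) * nash u O / k * Fintype.card (Perm (Fin N)) -
        (∑ σ : Perm (Fin N), nash u (hired u tie s (List.ofFn σ) i)) / (k - i) ≤
      ∑ σ : Perm (Fin N), bestIncrease u tie hN hs hi σ := by
  set T : Perm (Fin N) → Finset (Fin N) := fun σ => hired u tie s (List.ofFn σ) i with hT
  set Q : Finset (Fin N) := univ.map ⟨segment hN hi, segment_injective hN hi⟩ with hQ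
  set R : Finset (Fin N) := {q | i * s ≤ (q : ℕ)} with hR
  have memR : ∀ q, q ∈ R ↔ i * s ≤ (q : ℕ) := fun q => by simp [hR]
  have hk0 : (0 : ℝ) < k := by exact_mod_cast (by omega : 0 < k)
  have hs0 : (0 : ℝ) < s := by exact_mod_cast hs
  have hN0 : 0 < N := hN ▸ Nat.mul_pos (by omega) hs
  have hi' : (0 : ℝ) < k - i := by rw [sub_pos]; exact_mod_cast hi
  have hQR : Q ⊆ R := by
    intro q hq
    obtain ⟨l, -, rfl⟩ := mem_map.1 hq
    exact (memR _).2 (Nat.le_add_right _ _)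
  have cardQ : #Q = s := by simp [hQ]
  have cardR : (#R : ℝ) = (k - i) * s := by
    have h1 : #R = N - i * s := by
      rw [← Fin.card_Ici ⟨i * s, by simpa using segment_lt hN hi ⟨0, hs⟩⟩]
      congr 1
      ext q
      rw [memR, mem_Ici, Fin.le_def]
    rw [h1, hN, ← Nat.sub_mul, Nat.cast_mul, Nat.cast_sub hi.le]
  obtain ⟨w, hw, hwO⟩ := exists_additive_minorant hu O
  -- A maximum dominates an average; if `O` misses the segment, the quotient is `0` by convention.
  have average : ∀ σ : Perm (Fin N),
      (∑ o ∈ within O Q σ, (gain u (T σ) o - nash u (T σ))) / #(within O Q σ) ≤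
        bestIncrease u tie hN hs hi σ := by
    intro σ
    rcases (#(within O Q σ)).eq_zero_or_pos with h | h
    · rw [h, Nat.cast_zero, div_zero]
      exact bestIncrease_nonneg hu hN hs hi σ
    · rw [div_le_iff₀ (by exact_mod_cast h), mul_comm, ← nsmul_eq_mul]
      refine sum_le_card_nsmul _ _ _ fun o ho => ?_
      obtain ⟨l, -, hl⟩ := mem_map.1 (mem_within.1 ho).2
      have := le_bestIncrease (u := u) (tie := tie) hN hs hi σ l
      rwa [show σ (segment hN hi l) = o from (eq_symm_apply σ).1 hl] at this
  have remaining : ∀ σ : Perm (Fin N), ∑ o ∈ within O R σ, w o - nash u (T σ) ≤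
      ∑ o ∈ within O R σ, (gain u (T σ) o - nash u (T σ)) := by
    intro σ
    refine (sub_le_sub_right (hw _ (filter_subset _ _)) _).trans
      (nash_sub_le_sum_gain hu fun o ho h => ?_)
    have h1 := (memR _).1 (mem_within.1 ho).2
    have h2 := symm_lt_of_mem_hired h
    omega
  have swap_value := sum_average_within O hQR (fun o σ => gain u (T σ) o - nash u (T σ)) <| by
    intro σ a ha b hb c
    have : T (swap a b * σ) = T σ := by
      refine hired_ofFn_congr i fun q hq => ?_
      rw [Perm.mul_apply, swap_apply_of_ne_of_ne]
      · rintro rfl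
        have := (memR _).1 (mem_within.1 ha).2
        rw [symm_apply_apply] at this
        omega
      · rintro rfl
        have := (memR _).1 (mem_within.1 hb).2
        rw [symm_apply_apply] at this
        omega
    simp only [this]
  have additive := sum_hit_mul_additive (O := O) hQR w
  have spent := sum_hit_mul_le (O := O) hQR (fun σ => nash u (T σ)) (fun σ => nash_nonneg hu _)
    fun σ a ha b hb => by
      simp only [hT]
      rw [hired_mul_swap σ ((memR a).1 ha) ((memR b).1 hb)]
  -- The segment is a fraction `1 / k` of the stream and `O` has `k` members, so it is missed with
  -- probability at most `(1 - 1 / k) ^ k ≤ 1 / e`.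
  have hits : (1 - 1 / Real.exp 1) * Fintype.card (Perm (Fin N)) ≤ ∑ σ, hit O Q σ := by
    have : Nonempty (Fin N) := ⟨⟨0, hN0⟩⟩
    have h1 := sum_one_sub_hit_le O Q
    rw [sum_sub_distrib, sum_const, card_univ, nsmul_one, cardQ, Fintype.card_fin, hO] at h1
    have h2 : (1 - (s : ℝ) / N) ^ k ≤ 1 / Real.exp 1 := by
      have h3 : (s : ℝ) / N = 1 / k := by
        rw [hN, Nat.cast_mul]
        field_simp
      rw [h3, one_div (Real.exp 1), ← Real.exp_neg]
      exact Real.one_sub_div_pow_le_exp_neg (by exact_mod_cast (by omega : 1 ≤ k))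
    have h4 := mul_le_mul_of_nonneg_right h2
      (Nat.cast_nonneg (α := ℝ) (Fintype.card (Perm (Fin N))))
    linarith
  rw [hO, hwO] at additive
  rw [cardR, cardQ] at spent
  have h1 : (1 - 1 / Real.exp 1) * nash u O / k * Fintype.card (Perm (Fin N)) ≤
      ∑ σ, hit O Q σ / #(within O R σ) * ∑ o ∈ within O R σ, w o := by
    rw [div_mul_eq_mul_div, div_le_iff₀ hk0, mul_comm _ (k : ℝ), additive]
    calc _ = nash u O * ((1 - 1 / Real.exp 1) * Fintype.card (Perm (Fin N))) := by ring
      _ ≤ _ := mul_le_mul_of_nonneg_left hits (nash_nonneg hu O)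
  have h2 : ∑ σ, hit O Q σ / #(within O R σ) * nash u (T σ) ≤
      (∑ σ, nash u (T σ)) / (k - i) := by
    rw [le_div_iff₀ hi']
    refine le_of_mul_le_mul_left (le_trans (le_of_eq ?_) spent) hs0
    ring
  calc _ ≤ ∑ σ, hit O Q σ / #(within O R σ) * ∑ o ∈ within O R σ, w o -
        ∑ σ, hit O Q σ / #(within O R σ) * nash u (T σ) := sub_le_sub h1 h2
    _ = ∑ σ, hit O Q σ / #(within O R σ) * (∑ o ∈ within O R σ, w o - nash u (T σ)) := by
        rw [← sum_sub_distrib]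
        exact sum_congr rfl fun σ _ => by ring
    _ ≤ ∑ σ, hit O Q σ / #(within O R σ) *
          ∑ o ∈ within O R σ, (gain u (T σ) o - nash u (T σ)) :=
        sum_le_sum fun σ _ => mul_le_mul_of_nonneg_left (remaining σ)
          (div_nonneg (hit_nonneg O Q σ) (by positivity))
    _ = _ := swap_value.symm
    _ ≤ _ := sum_le_sum fun σ _ => average σ

end Rule

/-! ### Solving the recursion. -/

section Recursion

/-- A monotone sequence whose increments satisfy the bound of the Online Nash Rule reaches `B / 7`
after `k` steps. -/
theorem div_seven_le_of_increments {k : ℕ} (hk : 2 ≤ k) {V : ℕ → ℝ} {B : ℝ} (h0 : 0 ≤ V 0)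
    (hV : Monotone V)
    (h : ∀ i < k, 3 / 10 * (B / k - V i / (k - i)) ≤ V (i + 1) - V i) : B / 7 ≤ V k := by
  have hk0 : (0 : ℝ) < k := by exact_mod_cast (by omega : 0 < k)
  have hA : 0 ≤ V k := h0.trans (hV (Nat.zero_le k))
  -- Bound `V t` by `V k` and `k / (k - t)` by `1 + 3 t / k`, which is valid for `3 t ≤ 2 k`;
  -- summing over the first `t` steps gives the quadratic term.
  have step : ∀ t ≤ k, 3 * t ≤ 2 * k + 3 →
      3 / 10 * (t * B / k - V k * (t + 3 * t * (t - 1) / (2 * k)) / k) ≤ V t := by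
    intro t
    induction t with
    | zero => intro _ _; simpa using h0
    | succ t ih =>
      intro ht ht3
      have ih := ih (by omega) (by omega)
      have hi := h t (by omega)
      have htk : (t : ℝ) + 1 ≤ k := by exact_mod_cast ht
      have ht3 : 3 * (t : ℝ) ≤ 2 * k := by exact_mod_cast (by omega : 3 * t ≤ 2 * k)
      have hVt : V t / (k - t) ≤ V k * ((1 + 3 * t / k) / k) := by
        rw [div_le_iff₀ (by linarith), mul_assoc]
        have h1 : 1 ≤ (1 + 3 * t / k) / k * (k - t : ℝ) := by
          rw [show (1 + 3 * t / k) / k * (k - t : ℝ) = (k + 3 * t) * (k - t) / (k * k) by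
            field_simp, one_le_div (by positivity)]
          nlinarith [mul_nonneg (Nat.cast_nonneg (α := ℝ) t) (sub_nonneg.2 ht3)]
        exact (hV (by omega)).trans (le_mul_of_one_le_right hA h1)
      have e : 3 / 10 * (((t + 1 : ℕ) : ℝ) * B / k -
          V k * (((t + 1 : ℕ) : ℝ) + 3 * ((t + 1 : ℕ) : ℝ) * (((t + 1 : ℕ) : ℝ) - 1) / (2 * k)) / k)
          = 3 / 10 * (t * B / k - V k * (t + 3 * t * (t - 1) / (2 * k)) / k) +
            3 / 10 * (B / k - V k * ((1 + 3 * t / k) / k)) := by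
        push_cast
        field_simp
        ring
      rw [e]
      linarith
  -- Later steps are discarded: near `t = k` the bound on the increments degenerates.
  obtain ⟨t, ht, ht3, ht2⟩ : ∃ t ≤ k, 3 * t ≤ 2 * k + 3 ∧ 2 * k ≤ 3 * t :=
    ⟨2 * k / 3 + 1, by omega, by omega, by omega⟩
  have hVt := (step t ht ht3).trans (hV ht)
  have ht3 : 3 * (t : ℝ) ≤ 2 * k + 3 := by exact_mod_cast ht3
  have ht2 : 2 * (k : ℝ) ≤ 3 * t := by exact_mod_cast ht2
  have ht0 : (0 : ℝ) < t := by linarith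
  -- At `t / k = 2 / 3`, dropping the lower-order term, both sides equal `7 / 5`. The constant `7`
  -- arises as `(21 / 10) / (3 / 10)`.
  have coef : 1 + 3 / 10 * ((t + 3 * t * (t - 1) / (2 * k)) / k) ≤ 21 / 10 * (t / k : ℝ) := by
    rw [← sub_nonneg, show 21 / 10 * (t / k : ℝ) -
      (1 + 3 / 10 * ((t + 3 * t * (t - 1) / (2 * k)) / k)) =
        (18 * t * k * 2 - 20 * k * k - 9 * t * (t - 1)) / (20 * k * k) by field_simp; ring]
    refine div_nonneg ?_ (by positivity)
    nlinarith [mul_nonneg ht0.le (by linarith : 0 ≤ 2 * (k : ℝ) + 3 - 3 * t),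
      mul_nonneg hk0.le (by linarith : 0 ≤ 3 * (t : ℝ) - 2 * k)]
  have h1 : 3 / 10 * (t / k) * B ≤ 21 / 10 * (t / k : ℝ) * V k := by
    have h2 := mul_le_mul_of_nonneg_right coef hA
    have h3 : 3 / 10 * (t * B / k - V k * (t + 3 * t * (t - 1) / (2 * k)) / k) =
      3 / 10 * (t / k) * B -
        3 / 10 * ((t + 3 * t * (t - 1) / (2 * k)) / k) * V k := by ring
    linarith
  have hx : (0 : ℝ) < t / k := by positivity
  have : (t / k : ℝ) * (B / 7) ≤ t / k * V k := by linarith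
  exact le_of_mul_le_mul_left this hx

end Recursion

/-! ### Dummy candidates and the offline optimum. -/

section Dummies

open Finset

variable {n m N : ℕ} {u : Fin n → Fin m → ℝ}

theorem padded_nonneg (hu : ∀ i c, 0 ≤ u i c) (i : Fin n) (x : Fin N) : 0 ≤ padded N u i x := by
  rw [padded]
  split_ifs
  · exact hu _ _
  · rfl

theorem nash_padded_map (h : m ≤ N) (W : Finset (Fin m)) :
    nash (padded N u) (W.map (Fin.castLEEmb h)) = nash u W := by
  simp [nash, padded]

theorem nash_filter_exists (h : m ≤ N) (S : Finset (Fin N)) :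
    nash u (univ.filter fun c : Fin m => ∃ x ∈ S, (x : ℕ) = (c : ℕ)) = nash (padded N u) S := by
  rw [← nash_padded_map h]
  refine sum_congr rfl fun i _ => ?_
  congr 2
  refine sum_subset (fun x hx => ?_) fun x hx hx' => ?_
  · obtain ⟨c, hc, rfl⟩ := mem_map.1 hx
    obtain ⟨y, hy, hyc⟩ := (mem_filter.1 hc).2
    rwa [show Fin.castLEEmb h c = y from Fin.ext hyc.symm]
  · refine dif_neg fun hlt => hx' (mem_map.2 ⟨⟨x, hlt⟩, ?_, rfl⟩)
    exact mem_filter.2 ⟨mem_univ _, x, hx, rfl⟩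

theorem card_filter_exists_le (S : Finset (Fin N)) :
    #(univ.filter fun c : Fin m => ∃ x ∈ S, (x : ℕ) = (c : ℕ)) ≤ #S := by
  rw [← card_map Fin.valEmbedding, ← card_map (s := S) Fin.valEmbedding]
  refine card_le_card fun c hc => ?_
  obtain ⟨d, hd, rfl⟩ := mem_map.1 hc
  obtain ⟨x, hx, hxc⟩ := (mem_filter.1 hd).2
  exact mem_map.2 ⟨x, hx, hxc⟩

theorem le_streamLength {k : ℕ} (hk : 0 < k) : m ≤ streamLength m k := by
  simpa [streamLength] using le_smul_ceilDiv (b := m) hk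

/-- By monotonicity an optimum can be filled up; exactly `k` members are needed for the hitting
probability. -/
theorem exists_card_eq_maxNash_le {k : ℕ} (hkm : k ≤ m) (hu : ∀ i c, 0 ≤ u i c) :
    ∃ W : Finset (Fin m), #W = k ∧ maxNash k u ≤ nash u W := by
  obtain ⟨W, hW, h⟩ := exists_mem_eq_sup' (s := univ.filter fun W : Finset (Fin m) => #W ≤ k)
    ⟨∅, by simp⟩ (nash u)
  obtain ⟨W', hWW', hW'⟩ := exists_superset_card_eq (mem_filter.1 hW).2
    (by simpa using hkm)
  exact ⟨W', hW', h.trans_le (nash_mono hu hWW')⟩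

end Dummies

end OnlineNash

/-! ### Assembly. -/

theorem theorem6 (n m k : ℕ) (hk : 2 ≤ k) (hkm : k < m)
    (u : Fin n → Fin m → ℝ) (hu : ∀ i c, 0 ≤ u i c)
    (tie : Fin (OnlineNash.streamLength m k) → ℕ) :
    (∀ σ : Equiv.Perm (Fin (OnlineNash.streamLength m k)),
        (OnlineNash.rule k u tie σ).card ≤ k) ∧
      (OnlineNash.ResolvesTies k (OnlineNash.padded (OnlineNash.streamLength m k) u) tie →
        (1 - 1 / Real.exp 1) / 7 * OnlineNash.maxNash k u ≤
          𝔼 σ : Equiv.Perm (Fin (OnlineNash.streamLength m k)),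
            OnlineNash.nash u (OnlineNash.rule k u tie σ)) := by
  refine ⟨fun σ => (OnlineNash.card_filter_exists_le _).trans (OnlineNash.card_hired_le k),
    fun hres => ?_⟩
  have hm := OnlineNash.le_streamLength (m := m) (by omega : 0 < k)
  have hs : 2 ≤ m ⌈/⌉ k := by
    by_contra h
    have h1 := Nat.mul_le_mul_left k (by omega : m ⌈/⌉ k ≤ 1)
    have : m ≤ k * (m ⌈/⌉ k) := hm
    omega
  have hN : OnlineNash.streamLength m k = k * (m ⌈/⌉ k) := rfl
  have hu' := OnlineNash.padded_nonneg (N := OnlineNash.streamLength m k) hu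
  obtain ⟨W, hW, hmax⟩ := OnlineNash.exists_card_eq_maxNash_le hkm.le hu
  rw [Fintype.expect_eq_sum_div_card]
  simp only [OnlineNash.rule, OnlineNash.nash_filter_exists hm]
  rw [le_div_iff₀ (by exact_mod_cast Fintype.card_pos)]
  -- The recursion is applied to sums over all arrangements instead of averages, so `B` carries the
  -- number of arrangements.
  have key := OnlineNash.div_seven_le_of_increments hk
    (B := (1 - 1 / Real.exp 1) * OnlineNash.nash u W *
      Fintype.card (Equiv.Perm (Fin (OnlineNash.streamLength m k))))
    (V := fun i => ∑ σ : Equiv.Perm (Fin (OnlineNash.streamLength m k)),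
      OnlineNash.nash (OnlineNash.padded (OnlineNash.streamLength m k) u)
        (OnlineNash.hired (OnlineNash.padded (OnlineNash.streamLength m k) u) tie (m ⌈/⌉ k)
          (List.ofFn σ) i))
    (Finset.sum_nonneg fun σ _ => OnlineNash.nash_nonneg hu' _)
    (monotone_nat_of_le_succ fun i => Finset.sum_le_sum fun σ _ =>
      OnlineNash.nash_mono hu' Finset.subset_union_left) fun i hi => by
      have h1 := OnlineNash.sum_bestIncrease_le hu' hN hs hres hi
      have h2 := OnlineNash.le_sum_bestIncrease (tie := tie) hu' hN (by omega) hi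
        (O := W.map (Fin.castLEEmb hm)) (by rw [Finset.card_map, hW])
      rw [Finset.sum_sub_distrib] at h1
      rw [OnlineNash.nash_padded_map, div_mul_eq_mul_div] at h2
      linarith
  refine le_trans ?_ key
  have he : 0 ≤ 1 - 1 / Real.exp 1 := by
    rw [sub_nonneg, div_le_one (Real.exp_pos 1)]
    exact Real.one_le_exp zero_le_one
  have := mul_le_mul_of_nonneg_right (mul_le_mul_of_nonneg_left hmax he)
    (Nat.cast_nonneg (α := ℝ)
      (Fintype.card (Equiv.Perm (Fin (OnlineNash.streamLength m k)))))
  linarith
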